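/- A \emph{public scenario} $S_p=(I_A,M,O)$ consists of a finite set of agents $I_A=\{1,\dots,N\}$, for each agent $i$ a finite set of measurements $M_i=\{1,\dots,m_i\}$, and for each measurement $x_i\in M_i$ of agent $i$ a finite set of outcomes $O_{x_i}$; all these sets have at least two elements. The measurement $x_i=1$ is called the query measurement of agent $i$. A \emph{behaviour} is a family $\wp(\vec a|\vec x)$ of probability distributions, one for each $\vec x\in M_1\times\dots\times M_N$, on the outcome strings $\vec a\in O_{x_1}\times\dots\times O_{x_N}$. It satisfies \emph{Local Agency} if for every $V\subset I_A$ its marginal on the outcomes of the agents in $V$ depends on $\vec x$ only through $\vec x_V$. The set $\mathcal B(S_p)$ consists of the behaviours that have a local hidden variable model: $\wp(\vec a|\vec x)=\int_\Lambda \prod_{i=1}^N P(a_i|x_i,\lambda)\,d\mu(\lambda)$ for some probability space $(\Lambda,\mu)$ and probability distributions $P(\cdot|x_i,\lambda)$ on $O_{x_i}$ that are measurable in $\lambda$. For a set $I_F\subset I_A$ (the agents that have a friend), the set $\mathcal{LF}(S)$ of Local Friendliness behaviours of the scenario $S=(S_p,I_F)$ consists of the behaviours that can be written as $$\wp(\vec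 a|\vec x)=\sum_{\vec c}\Big(\prod_{i\in F_{\vec x}}\delta_{a_i,c_i}\Big)\,P(\vec a_{J_{\vec x}}|\vec x_{J_{\vec x}},\vec c)\,P(\vec c),$$ where $\vec c$ ranges over $\prod_{i\in I_F}O_{x_i=1}$, $F_{\vec x}=\{i\in I_F: x_i=1\}$, $J_{\vec x}=I_A\setminus F_{\vec x}$, $P(\vec c)$ is a probability distribution, and for each $\vec c$ the family $P(\cdot|\cdot,\vec c)$ is a behaviour that satisfies Local Agency. \textbf{Theorem.} Let $S=(S_p,I_F)$ and $S'=(S_p,I_F')$ have the same public scenario, with $\emptyset\neq I_F'\subsetneq I_F\subset I_A$. Then either $\mathcal{LF}(S)=\mathcal{LF}(S')=\mathcal B(S_p)$, or $\mathcal{LF}(S)\subsetneq\mathcal{LF}(S')$. Moreover, equality $\mathcal{LF}(S)=\mathcal{LF}(S')$ holds exactly when $I_F=I_A$, $|I_F'|=N-1$ and $m_j=2$ for all $j\in I_F'$. -/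

import Mathlib

open MeasureTheory

noncomputable section

namespace LocalFriendliness

/-- A public scenario `S_p = (I_A, M, O)`: agents `I_A = Fin N`, measurements `M i = Fin (m i)`
of agent `i`, and outcomes `Fin (o i s)` of the measurement `s` of agent `i`.
All these sets have at least two elements. -/
structure PublicScenario where
  N : ℕ
  m : Fin N → ℕ
  o : (i : Fin N) → Fin (m i) → ℕ
  two_le_N : 2 ≤ N
  two_le_m : ∀ i, 2 ≤ m i
  two_le_o : ∀ i s, 2 ≤ o i s

namespace PublicScenario

variable (S : PublicScenario)

/-- The query measurement of agent `i`, that is, the first of its measurements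
(the one labelled `1` when labels start at `1`). -/
def query (i : Fin S.N) : Fin (S.m i) :=
  ⟨0, lt_of_lt_of_le Nat.two_pos (S.two_le_m i)⟩

/-- Strings of inputs `x`, one measurement for each agent. -/
abbrev Inputs : Type := (i : Fin S.N) → Fin (S.m i)

/-- Strings of outcomes for the string of inputs `x`. -/
abbrev Outcomes (x : S.Inputs) : Type := (i : Fin S.N) → Fin (S.o i (x i))

/-- Families of real numbers `p (a | x)`, that is, points of `ℝ ^ D`. -/
abbrev Table : Type := (x : S.Inputs) → S.Outcomes x → ℝ

variable {S}

/-- A behaviour: for every string of inputs, a probability distribution on the outcomes. -/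
def IsBehaviour (p : S.Table) : Prop :=
  (∀ x a, 0 ≤ p x a) ∧ ∀ x, ∑ a, p x a = 1

/-- The marginal `p (a_V | x)`: the sum of `p (a' | x)` over all `a'` that agree with `a` on `V`. -/
def marginal (p : S.Table) (V : Finset (Fin S.N)) (x : S.Inputs) (a : S.Outcomes x) : ℝ :=
  ∑ a' : S.Outcomes x with ∀ i ∈ V, a' i = a i, p x a'

/-- Local Agency: for every set `V` of agents, the marginal `p (a_V | x)` depends on `x` only
through `x_V`. Outcomes for two different strings of inputs are compared by their labels. -/
def LocalAgency (p : S.Table) : Prop :=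
  ∀ (V : Finset (Fin S.N)) (x y : S.Inputs), (∀ i ∈ V, x i = y i) →
    ∀ (a : S.Outcomes x) (b : S.Outcomes y), (∀ i ∈ V, (a i : ℕ) = (b i : ℕ)) →
      marginal p V x a = marginal p V y b

variable (S)

/-- The set `B(S_p)` of the behaviours that have a local hidden variable model. -/
def Bell : Set S.Table :=
  {p | IsBehaviour p ∧
    ∃ (Λ : Type) (_ : MeasurableSpace Λ) (μ : Measure Λ)
      (P : (i : Fin S.N) → (s : Fin (S.m i)) → Λ → Fin (S.o i s) → ℝ),
      IsProbabilityMeasure μ ∧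
      (∀ i s a, Measurable fun l => P i s l a) ∧
      (∀ i s l a, 0 ≤ P i s l a) ∧
      (∀ i s l, ∑ a, P i s l a = 1) ∧
      ∀ x a, p x a = ∫ l, ∏ i, P i (x i) l (a i) ∂μ}

/-- The set `F_x` of the agents in `F` that choose their query measurement in `x`. -/
def queried (F : Finset (Fin S.N)) (x : S.Inputs) : Finset (Fin S.N) :=
  F.filter (fun i => x i = S.query i)

/-- Strings `c` of outcomes observed by the friends, with `c i` an outcome of the query
measurement at site `i`, for `i` in the set `F` of friends. -/
abbrev FriendOutcomes (F : Finset (Fin S.N)) : Type :=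
  (i : {i // i ∈ F}) → Fin (S.o i (S.query i))

/-- The set `LF(S_p, F)` of the Local Friendliness behaviours for the set `F` of friends:
`p (a | x) = ∑ c, (∏ i ∈ F_x, δ (a i, c i)) * P (a_{J_x} | x_{J_x}, c) * P (c)`, where `F_x` is
the set of the agents in `F` that choose the query measurement in `x`, `J_x` is its complement
in the set of all agents, and `P ( · | · , c)` satisfies Local Agency for every `c`. -/
def LF (F : Finset (Fin S.N)) : Set S.Table :=
  {p | IsBehaviour p ∧
    ∃ (w : S.FriendOutcomes F → ℝ) (P : S.FriendOutcomes F → S.Table),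
      (∀ c, 0 ≤ w c) ∧ ∑ c, w c = 1 ∧
      (∀ c, IsBehaviour (P c)) ∧
      (∀ c, LocalAgency (P c)) ∧
      ∀ x a, p x a = ∑ c : S.FriendOutcomes F,
        (∏ i ∈ Finset.univ.filter (fun i : {i // i ∈ F} => x i.1 = S.query i.1),
            if (a i.1 : ℕ) = (c i : ℕ) then (1 : ℝ) else 0) *
          marginal (P c) (S.queried F x)ᶜ x a * w c}

end PublicScenario

end LocalFriendliness

end

noncomputable section

namespace LocalFriendliness

namespace PublicScenario

variable {S : PublicScenario}

/-! A behaviour is Local Friendliness for `F` exactly when it is a finite mixture of Local Agency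
behaviours in each of which every queried agent of `F` has a fixed outcome
(`exists_mixture_of_mem_LF`, `mixture_mem_LF`). More friends means more fixed outcomes, so the sets
shrink as `F` grows (`LF_anti`); a deterministic local strategy fixes everything, so each of them
contains the Bell set (`bell_subset_LF`). If all agents but `n` have a friend and two measurements,
then within a component `c` one outcome is fixed by `c` and only one measurement remains. Those
remaining outcomes can be sampled jointly as a hidden variable, and `n` answers conditionally on
them: this is a local model (`LF_compl_singleton_subset_bell`), and all the sets coincide. Otherwise
take `j` in `F` but not in `F'`, and a partner `k` having two measurements that no friend in `F'`
controls. A PR box between them lies in the set for `F'` (`prTable_mem_LF`). It is excluded by a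
friend of `j` (`prTable_not_mem_LF`), since a fixed outcome of `j` propagates through the perfect
correlations until they contradict each other. -/

/-! ### Local Agency in terms of outcome labels. -/

/-- The probability that the outcomes of the agents in `V` carry the labels `l`. -/
def labelMarginal (p : S.Table) (V : Finset (Fin S.N)) (x : S.Inputs) (l : Fin S.N → ℕ) : ℝ :=
  ∑ a : S.Outcomes x, if ∀ i ∈ V, (a i : ℕ) = l i then p x a else 0

theorem marginal_eq_labelMarginal (p : S.Table) (V : Finset (Fin S.N)) (x : S.Inputs)
    (a : S.Outcomes x) : marginal p V x a = labelMarginal p V x fun i => a i := by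
  simp only [marginal, labelMarginal, Finset.sum_filter, Fin.ext_iff]

theorem exists_outcomes_agree {V : Finset (Fin S.N)} {x y : S.Inputs} (h : ∀ i ∈ V, x i = y i)
    (a : S.Outcomes x) : ∃ b : S.Outcomes y, ∀ i ∈ V, (b i : ℕ) = a i := by
  refine ⟨fun i => if hi : i ∈ V then ⟨a i, by rw [← h i hi]; exact (a i).2⟩ else
    ⟨0, by have := S.two_le_o i (y i); omega⟩, fun i hi => ?_⟩
  simp [hi]

/-- Labels in `ℕ` avoid comparing outcome types that depend on the inputs. Labels that no outcome
string attains on `V` give zero on both sides. -/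
theorem localAgency_iff (p : S.Table) : LocalAgency p ↔
    ∀ (V : Finset (Fin S.N)) (x y : S.Inputs), (∀ i ∈ V, x i = y i) →
      ∀ l, labelMarginal p V x l = labelMarginal p V y l := by
  constructor
  · intro h V x y hxy l
    by_cases ha : ∃ a : S.Outcomes x, ∀ i ∈ V, (a i : ℕ) = l i
    · obtain ⟨a, ha⟩ := ha
      obtain ⟨b, hb⟩ := exists_outcomes_agree hxy a
      have key := h V x y hxy a b fun i hi => (hb i hi).symm
      rw [marginal_eq_labelMarginal, marginal_eq_labelMarginal] at key
      convert key using 1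
      · exact Finset.sum_congr rfl fun a' _ => if_congr
          (forall₂_congr fun i hi => by simp only [ha i hi]) rfl rfl
      · exact Finset.sum_congr rfl fun a' _ => if_congr
          (forall₂_congr fun i hi => by simp only [hb i hi, ha i hi]) rfl rfl
    · have hb : ¬ ∃ b : S.Outcomes y, ∀ i ∈ V, (b i : ℕ) = l i := by
        rintro ⟨b, hb⟩
        obtain ⟨a, ha'⟩ := exists_outcomes_agree (fun i hi => (hxy i hi).symm) b
        exact ha ⟨a, fun i hi => (ha' i hi).trans (hb i hi)⟩
      push Not at ha hb
      rw [labelMarginal, labelMarginal, Finset.sum_eq_zero, Finset.sum_eq_zero]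
      · intro b _
        rw [if_neg]; push Not; exact hb b
      · intro b _
        rw [if_neg]; push Not; exact ha b
  · intro h V x y hxy a b hab
    rw [marginal_eq_labelMarginal, marginal_eq_labelMarginal, h V x y hxy]
    exact Finset.sum_congr rfl fun a' _ => if_congr
      (forall₂_congr fun i hi => by simp only [hab i hi]) rfl rfl

theorem le_labelMarginal {p : S.Table} (hp : ∀ x a, 0 ≤ p x a) (V : Finset (Fin S.N))
    (x : S.Inputs) (a : S.Outcomes x) (l : Fin S.N → ℕ) (h : ∀ i ∈ V, (a i : ℕ) = l i) :
    p x a ≤ labelMarginal p V x l := by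
  have := Finset.single_le_sum (f := fun a : S.Outcomes x =>
    if ∀ i ∈ V, (a i : ℕ) = l i then p x a else 0)
    (fun a _ => by split_ifs <;> simp [hp]) (Finset.mem_univ a)
  exact (if_pos h).symm.trans_le this

/-- No-signalling for the single agent `i`: an outcome that is certain for one input string stays
certain when the other agents change their measurements. -/
theorem LocalAgency.label_eq_of_forall {p : S.Table} (hp : LocalAgency p)
    (h0 : ∀ x a, 0 ≤ p x a) {x y : S.Inputs} {i : Fin S.N} (hxy : x i = y i) {n : ℕ}
    (hx : ∀ a, p x a ≠ 0 → (a i : ℕ) = n) (b : S.Outcomes y) (hb : p y b ≠ 0) :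
    (b i : ℕ) = n := by
  by_contra hne
  have h1 := le_labelMarginal h0 {i} y b (fun _ => b i) (by simp)
  rw [← (localAgency_iff p).1 hp {i} x y (by simpa using hxy)] at h1
  have h2 : labelMarginal p {i} x (fun _ => b i) = 0 := by
    refine Finset.sum_eq_zero fun a _ => ?_
    split_ifs with h
    · by_contra h'
      exact hne (by rw [← hx a h', h i (by simp)])
    · rfl
  exact hb (le_antisymm (h1.trans_eq h2) (h0 y b))

theorem IsBehaviour.exists_ne_zero {p : S.Table} (hp : IsBehaviour p) (x : S.Inputs) :
    ∃ a, p x a ≠ 0 := by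
  by_contra! h
  have := hp.2 x
  simp [h] at this

/-! ### Pushforwards and mixtures of tables. -/

/-- The table in which the outcome string `g x k` has weight `w x k`. -/
def pushTable {K : S.Inputs → Type} [∀ x, Fintype (K x)] (w : (x : S.Inputs) → K x → ℝ)
    (g : (x : S.Inputs) → K x → S.Outcomes x) : S.Table :=
  fun x a => ∑ k, if a = g x k then w x k else 0

section pushTable

variable {K : S.Inputs → Type} [∀ x, Fintype (K x)] {w : (x : S.Inputs) → K x → ℝ}
  {g : (x : S.Inputs) → K x → S.Outcomes x}

theorem isBehaviour_pushTable (h0 : ∀ x k, 0 ≤ w x k) (h1 : ∀ x, ∑ k, w x k = 1) :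
    IsBehaviour (pushTable w g) := by
  refine ⟨fun x a => Finset.sum_nonneg fun k _ => by split_ifs <;> simp [h0], fun x => ?_⟩
  simp only [pushTable]
  rw [Finset.sum_comm]
  simpa using h1 x

theorem labelMarginal_pushTable (V : Finset (Fin S.N)) (x : S.Inputs) (l : Fin S.N → ℕ) :
    labelMarginal (pushTable w g) V x l =
      ∑ k, if ∀ i ∈ V, (g x k i : ℕ) = l i then w x k else 0 := by
  simp only [labelMarginal, pushTable, ← Finset.sum_filter]
  rw [Finset.sum_filter, Finset.sum_congr rfl fun a _ =>
    show (if ∀ i ∈ V, (a i : ℕ) = l i then ∑ k with a = g x k, w x k else 0) =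
      ∑ k, if a = g x k then (if ∀ i ∈ V, (g x k i : ℕ) = l i then w x k else 0) else 0 from ?_]
  · rw [Finset.sum_comm]
    simp [Finset.sum_filter]
  · rw [Finset.sum_filter]
    split_ifs with h
    · refine Finset.sum_congr rfl fun k _ => ?_
      split_ifs with h1 h2 <;> first | rfl | (subst h1; exact absurd h h2)
    · refine (Finset.sum_eq_zero fun k _ => ?_).symm
      split_ifs with h1 h2 <;> first | rfl | (subst h1; exact absurd h2 h)

theorem exists_of_pushTable_ne_zero {x : S.Inputs} {a : S.Outcomes x}
    (h : pushTable w g x a ≠ 0) : ∃ k, a = g x k := by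
  obtain ⟨k, -, hk⟩ := Finset.exists_ne_zero_of_sum_ne_zero h
  exact ⟨k, by by_contra hne; simp [hne] at hk⟩

end pushTable

/-- Finite mixture of tables. -/
def mixture {K : Type} [Fintype K] (w : K → ℝ) (Q : K → S.Table) : S.Table :=
  fun x a => ∑ k, w k * Q k x a

section mixture

variable {K : Type} [Fintype K] {w : K → ℝ} {Q : K → S.Table}

theorem isBehaviour_mixture (h0 : ∀ k, 0 ≤ w k) (h1 : ∑ k, w k = 1)
    (hQ : ∀ k, IsBehaviour (Q k)) : IsBehaviour (mixture w Q) := by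
  refine ⟨fun x a => Finset.sum_nonneg fun k _ => mul_nonneg (h0 k) ((hQ k).1 x a), fun x => ?_⟩
  simp only [mixture]
  rw [Finset.sum_comm]
  simp only [← Finset.mul_sum, (hQ _).2, mul_one, h1]

theorem labelMarginal_mixture (V : Finset (Fin S.N)) (x : S.Inputs) (l : Fin S.N → ℕ) :
    labelMarginal (mixture w Q) V x l = ∑ k, w k * labelMarginal (Q k) V x l := by
  simp only [labelMarginal, mixture, Finset.mul_sum]
  rw [Finset.sum_comm]
  refine Finset.sum_congr rfl fun a _ => ?_
  split_ifs <;> simp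

theorem localAgency_mixture (hQ : ∀ k, LocalAgency (Q k)) : LocalAgency (mixture w Q) := by
  rw [localAgency_iff]
  intro V x y hxy l
  simp only [labelMarginal_mixture]
  exact Finset.sum_congr rfl fun k _ => by rw [(localAgency_iff _).1 (hQ k) V x y hxy l]

end mixture

/-! ### Local Friendliness behaviours as mixtures with revealed outcomes. -/

/-- The outcomes of the queried agents in `F` are almost surely those in `c`. -/
def Reveals (F : Finset (Fin S.N)) (c : S.FriendOutcomes F) (Q : S.Table) : Prop :=
  ∀ x a, Q x a ≠ 0 → ∀ i : {i // i ∈ F}, x i = S.query i → (a i : ℕ) = c i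

theorem Reveals.eq_prod_mul_marginal {F : Finset (Fin S.N)} {c : S.FriendOutcomes F} {Q : S.Table}
    (h : Reveals F c Q) (x : S.Inputs) (a : S.Outcomes x) :
    (∏ i ∈ Finset.univ.filter (fun i : {i // i ∈ F} => x i.1 = S.query i.1),
      if (a i.1 : ℕ) = (c i : ℕ) then (1 : ℝ) else 0) * marginal Q (S.queried F x)ᶜ x a
      = Q x a := by
  rw [Finset.prod_ite_zero]
  split_ifs with hc
  · simp only [Finset.prod_const_one, one_mul, marginal]
    refine Finset.sum_eq_single_of_mem a (by simp) fun a' ha' hne => ?_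
    by_contra h0
    refine hne (funext fun i => ?_)
    by_cases hi : i ∈ S.queried F x
    · have hi' := Finset.mem_filter.1 hi
      have e1 := h x a' h0 ⟨i, hi'.1⟩ hi'.2
      have e2 := hc ⟨i, hi'.1⟩ (by simpa using hi'.2)
      exact Fin.ext (e1.trans e2.symm)
    · exact (Finset.mem_filter.1 ha').2 i (by simpa using hi)
  · rw [zero_mul]
    by_contra h0
    exact hc fun i hi => h x a (Ne.symm h0) i (by simpa using hi)

/-- Replace the outcomes of the queried agents in `F` by those in `c`. -/
def overwrite (F : Finset (Fin S.N)) (c : S.FriendOutcomes F) (x : S.Inputs) (a : S.Outcomes x) :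
    S.Outcomes x := fun i =>
  if h : i ∈ F ∧ x i = S.query i then ⟨c ⟨i, h.1⟩, (c ⟨i, h.1⟩).2.trans_eq (congrArg (S.o i) h.2.symm)⟩ else a i

theorem reveals_overwrite (F : Finset (Fin S.N)) (c : S.FriendOutcomes F) (P : S.Table) :
    Reveals F c (pushTable P (overwrite F c)) := by
  intro x a h i hi
  obtain ⟨k, rfl⟩ := exists_of_pushTable_ne_zero h
  simp [overwrite, hi, i.2]

/-- A marginal on `V` after overwriting is either zero, when `c` contradicts the labels, or the old
marginal on the agents of `V` that are not queried. Both alternatives involve only the inputs in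
`V`. -/
theorem localAgency_overwrite (F : Finset (Fin S.N)) (c : S.FriendOutcomes F) {P : S.Table}
    (hP : LocalAgency P) : LocalAgency (pushTable P (overwrite F c)) := by
  rw [localAgency_iff] at hP ⊢
  intro V x y hxy l
  have key : ∀ z : S.Inputs, labelMarginal (pushTable P (overwrite F c)) V z l =
      if ∀ i : {i // i ∈ F}, i.1 ∈ V → z i = S.query i → (c i : ℕ) = l i then
        labelMarginal P (V \ S.queried F z) z l else 0 := by
    intro z
    rw [labelMarginal_pushTable]
    have hiff : ∀ a : S.Outcomes z, (∀ i ∈ V, (overwrite F c z a i : ℕ) = l i) ↔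
        (∀ i : {i // i ∈ F}, i.1 ∈ V → z i = S.query i → (c i : ℕ) = l i) ∧
          ∀ i ∈ V \ S.queried F z, (a i : ℕ) = l i := by
      intro a
      constructor
      · intro h
        refine ⟨fun i hi hq => ?_, fun i hi => ?_⟩
        · simpa [overwrite, hq, i.2] using h i hi
        · simp only [queried, Finset.mem_sdiff, Finset.mem_filter] at hi
          simpa [overwrite, hi.2] using h i hi.1
      · rintro ⟨h1, h2⟩ i hi
        by_cases hq : i ∈ F ∧ z i = S.query i
        · simpa [overwrite, hq] using h1 ⟨i, hq.1⟩ hi hq.2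
        · simpa [overwrite, hq] using h2 i (by simp [queried, hi]; tauto)
    simp only [hiff, labelMarginal]
    split_ifs with h
    · exact Finset.sum_congr rfl fun a _ => if_congr (and_iff_right h) rfl rfl
    · exact Finset.sum_eq_zero fun a _ => if_neg fun h' => h h'.1
  have hVq : V \ S.queried F x = V \ S.queried F y := by
    ext i
    simp only [queried, Finset.mem_sdiff, Finset.mem_filter]
    exact and_congr_right fun hi => by rw [hxy i hi]
  rw [key, key, hVq, hP _ x y fun i hi => hxy i (Finset.mem_sdiff.1 hi).1]
  exact if_congr (forall_congr' fun i => forall_congr' fun hi => by rw [hxy i hi]) rfl rfl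

theorem pushTable_overwrite (F : Finset (Fin S.N)) (c : S.FriendOutcomes F) (P : S.Table)
    (x : S.Inputs) (a : S.Outcomes x) : pushTable P (overwrite F c) x a =
      (∏ i ∈ Finset.univ.filter (fun i : {i // i ∈ F} => x i.1 = S.query i.1),
        if (a i.1 : ℕ) = (c i : ℕ) then (1 : ℝ) else 0) * marginal P (S.queried F x)ᶜ x a := by
  have hiff : ∀ a' : S.Outcomes x, a = overwrite F c x a' ↔
      (∀ i ∈ Finset.univ.filter (fun i : {i // i ∈ F} => x i.1 = S.query i.1),
        (a i.1 : ℕ) = (c i : ℕ)) ∧ ∀ i ∈ (S.queried F x)ᶜ, a' i = a i := by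
    intro a'
    constructor
    · rintro h
      refine ⟨fun i hi => ?_, fun i hi => ?_⟩
      · have hq : x i = S.query i := by simpa using hi
        simp [h, overwrite, hq, i.2]
      · simp only [queried, Finset.mem_compl, Finset.mem_filter] at hi
        simp [h, overwrite, hi]
    · rintro ⟨h1, h2⟩
      funext i
      by_cases hq : i ∈ F ∧ x i = S.query i
      · simpa [overwrite, hq, Fin.ext_iff] using h1 ⟨i, hq.1⟩ (by simpa using hq.2)
      · simpa [overwrite, hq] using (h2 i (by simp [queried]; tauto)).symm
  rw [Finset.prod_ite_zero]
  simp only [pushTable, hiff, marginal, Finset.sum_filter]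
  split_ifs with h
  · simp only [Finset.prod_const_one, one_mul]
    exact Finset.sum_congr rfl fun a' _ => if_congr (and_iff_right h) rfl rfl
  · rw [zero_mul]
    exact Finset.sum_eq_zero fun a _ => if_neg fun h' => h h'.1

theorem exists_mixture_of_mem_LF {F : Finset (Fin S.N)} {p : S.Table} (hp : p ∈ S.LF F) :
    ∃ (w : S.FriendOutcomes F → ℝ) (Q : S.FriendOutcomes F → S.Table),
      (∀ c, 0 ≤ w c) ∧ ∑ c, w c = 1 ∧ (∀ c, IsBehaviour (Q c)) ∧ (∀ c, LocalAgency (Q c)) ∧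
      (∀ c, Reveals F c (Q c)) ∧ p = mixture w Q := by
  obtain ⟨-, w, P, h0, h1, hP, hL, h⟩ := hp
  refine ⟨w, fun c => pushTable (P c) (overwrite F c), h0, h1,
    fun c => isBehaviour_pushTable (hP c).1 (hP c).2, fun c => localAgency_overwrite F c (hL c),
    fun c => reveals_overwrite F c (P c), ?_⟩
  funext x a
  rw [h]
  exact Finset.sum_congr rfl fun c _ => by simp only [pushTable_overwrite, mul_comm]

/-- Components with the same revealed string are merged, so the index type is free. -/
theorem mixture_mem_LF {K : Type} [Fintype K] {F : Finset (Fin S.N)} {w : K → ℝ}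
    {Q : K → S.Table} {c : K → S.FriendOutcomes F} (h0 : ∀ k, 0 ≤ w k) (h1 : ∑ k, w k = 1)
    (hQ : ∀ k, IsBehaviour (Q k)) (hL : ∀ k, LocalAgency (Q k))
    (hc : ∀ k, Reveals F (c k) (Q k)) : mixture w Q ∈ S.LF F := by
  classical
  have hK : Nonempty K := by
    by_contra hK
    rw [not_nonempty_iff] at hK
    simp at h1
  obtain ⟨k₀⟩ := hK
  let W : S.FriendOutcomes F → ℝ := fun d => ∑ k, if c k = d then w k else 0
  -- The conditional mixture given `d`; a string of weight zero gets an arbitrary component.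
  let P : S.FriendOutcomes F → S.Table := fun d =>
    if W d = 0 then Q k₀ else mixture (fun k => (if c k = d then w k else 0) / W d) Q
  have hW0 : ∀ d, 0 ≤ W d := fun d =>
    Finset.sum_nonneg fun k _ => by split_ifs <;> simp [h0]
  have hmix : ∀ d x a, W d * P d x a = ∑ k, (if c k = d then w k else 0) * Q k x a := by
    intro d x a
    by_cases hd : W d = 0
    · have hz := (Finset.sum_eq_zero_iff_of_nonneg
        (fun k _ => by split_ifs <;> simp [h0])).1 hd
      rw [hd, zero_mul, Finset.sum_eq_zero fun k hk => by rw [hz k hk, zero_mul]]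
    · simp only [P, if_neg hd, mixture, Finset.mul_sum]
      exact Finset.sum_congr rfl fun k _ => by field_simp
  refine ⟨isBehaviour_mixture h0 h1 hQ, W, P, hW0, ?_, fun d => ?_, fun d => ?_, fun x a => ?_⟩
  · simp only [W]
    rw [Finset.sum_comm]
    simpa using h1
  · by_cases hd : W d = 0
    · simpa only [P, if_pos hd] using hQ k₀
    · simp only [P, if_neg hd]
      refine isBehaviour_mixture (fun k => div_nonneg (by split_ifs <;> simp [h0]) (hW0 d)) ?_ hQ
      rw [← Finset.sum_div]
      exact div_self hd
  · by_cases hd : W d = 0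
    · simpa only [P, if_pos hd] using hL k₀
    · simp only [P, if_neg hd]
      exact localAgency_mixture hL
  · have hterm : ∀ d, (∏ i ∈ Finset.univ.filter (fun i : {i // i ∈ F} => x i.1 = S.query i.1),
        if (a i.1 : ℕ) = (d i : ℕ) then (1 : ℝ) else 0) *
          marginal (P d) (S.queried F x)ᶜ x a * W d = W d * P d x a := by
      intro d
      by_cases hd : W d = 0
      · simp [hd]
      · rw [Reveals.eq_prod_mul_marginal, mul_comm]
        intro y b hb
        simp only [P, if_neg hd] at hb
        obtain ⟨k, -, hk⟩ := Finset.exists_ne_zero_of_sum_ne_zero hb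
        have hkd : c k = d := by
          by_contra hne
          simp [hne] at hk
        rw [← hkd]
        exact hc k y b (right_ne_zero_of_mul hk)
    simp only [hterm, hmix]
    rw [Finset.sum_comm]
    refine Finset.sum_congr rfl fun k _ => ?_
    rw [← Finset.sum_mul]
    simp

theorem LF_anti {F F' : Finset (Fin S.N)} (h : F' ⊆ F) : S.LF F ⊆ S.LF F' := by
  intro p hp
  obtain ⟨w, Q, h0, h1, hQ, hL, hc, rfl⟩ := exists_mixture_of_mem_LF hp
  exact mixture_mem_LF (c := fun c i => c ⟨i, h i.2⟩) h0 h1 hQ hL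
    fun c x a ha i hi => hc c x a ha ⟨i, h i.2⟩ hi

/-! ### Local hidden variable models -/

theorem sum_ite_prod_eq {ι : Type*} [Fintype ι] [DecidableEq ι] {κ : ι → Type*}
    [∀ i, Fintype (κ i)] [∀ i, DecidableEq (κ i)] (q : ∀ i, κ i → ℝ)
    (hq : ∀ i, ∑ v, q i v = 1) (t : ι) (v : κ t) :
    ∑ f : ∀ i, κ i, (if v = f t then ∏ i, q i (f i) else 0) = q t v := by
  -- Absorbing the indicator into factor `t` turns the sum into a product of sums.
  let q' : ∀ i, κ i → ℝ := Function.update q t fun u => if v = u then q t u else 0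
  have h1 : ∀ f : ∀ i, κ i, (if v = f t then ∏ i, q i (f i) else 0) = ∏ i, q' i (f i) := by
    intro f
    rw [← Finset.mul_prod_erase _ _ (Finset.mem_univ t),
      ← Finset.mul_prod_erase _ (fun i => q' i (f i)) (Finset.mem_univ t),
      Finset.prod_congr rfl fun i hi => show q' i (f i) = q i (f i) by
        simp [q', Function.update_of_ne (Finset.ne_of_mem_erase hi)]]
    simp [q']
  have h2 := Finset.prod_univ_sum (fun i => (Finset.univ : Finset (κ i))) q'
  rw [Fintype.piFinset_univ] at h2
  rw [Finset.sum_congr rfl fun f _ => h1 f, ← h2, Fintype.prod_eq_single t]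
  · simp [q']
  · intro i hi
    simp [q', Function.update_of_ne hi, hq]

/-- Deterministic strategies: an outcome for every measurement of every agent. -/
abbrev Strategy (S : PublicScenario) : Type := (i : Fin S.N) → (s : Fin (S.m i)) → Fin (S.o i s)

/-- The behaviour of a deterministic strategy. -/
def Strategy.table (d : S.Strategy) : S.Table :=
  pushTable (K := fun _ => Unit) (fun _ _ => 1) fun x _ i => d i (x i)

theorem Strategy.localAgency_table (d : S.Strategy) : LocalAgency d.table := by
  rw [localAgency_iff]
  intro V x y hxy l
  simp only [Strategy.table, labelMarginal_pushTable]
  exact Finset.sum_congr rfl fun _ _ => if_congr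
    (forall₂_congr fun i hi => by rw [hxy i hi]) rfl rfl

/-- Fine's argument: randomness in the local responses can be moved into the hidden variable,
leaving a finite mixture of deterministic strategies. -/
theorem bell_subset_LF (F : Finset (Fin S.N)) : S.Bell ⊆ S.LF F := by
  rintro p ⟨-, Λ, _, μ, P, _, hm, h0, h1, h⟩
  have hle : ∀ i s l a, P i s l a ≤ 1 := fun i s l a =>
    (Finset.single_le_sum (f := P i s l) (fun a _ => h0 i s l a) (Finset.mem_univ a)).trans_eq
      (h1 i s l)
  -- The probability of drawing `d` when, given `l`, all outcomes of all measurements are drawn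
  -- independently.
  let G : S.Strategy → Λ → ℝ := fun d l => ∏ i, ∏ s, P i s l (d i s)
  have hG0 : ∀ d l, 0 ≤ G d l := fun d l =>
    Finset.prod_nonneg fun i _ => Finset.prod_nonneg fun s _ => h0 i s l _
  have hG1 : ∀ d l, G d l ≤ 1 := fun d l =>
    Finset.prod_le_one (fun i _ => Finset.prod_nonneg fun s _ => h0 i s l _) fun i _ =>
      Finset.prod_le_one (fun s _ => h0 i s l _) fun s _ => hle i s l _
  have hGm : ∀ d, Measurable (G d) := fun d =>
    Finset.measurable_fun_prod _ fun i _ => Finset.measurable_fun_prod _ fun s _ => hm i s _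
  have hGi : ∀ d, Integrable (G d) μ := fun d =>
    Integrable.of_mem_Icc 0 1 (hGm d).aemeasurable (ae_of_all _ fun l => ⟨hG0 d l, hG1 d l⟩)
  have hsum : ∀ l x (a : S.Outcomes x), ∏ i, P i (x i) l (a i) =
      ∑ d : S.Strategy, if a = (fun i => d i (x i)) then G d l else 0 := by
    intro l x a
    have h2 := Finset.prod_univ_sum
      (fun i => (Finset.univ : Finset ((s : Fin (S.m i)) → Fin (S.o i s))))
      (fun i f => if a i = f (x i) then ∏ s, P i s l (f s) else 0)
    rw [Fintype.piFinset_univ] at h2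
    rw [Finset.prod_congr rfl fun i _ =>
      (sum_ite_prod_eq (fun s => P i s l) (fun s => h1 i s l) (x i) (a i)).symm, h2]
    refine Finset.sum_congr rfl fun d _ => ?_
    simp only [Finset.prod_ite_zero, funext_iff, Finset.mem_univ, true_implies]
    exact if_congr Iff.rfl rfl rfl
  have hp : p = mixture (fun d => ∫ l, G d l ∂μ) Strategy.table := by
    funext x a
    rw [h, integral_congr_ae (ae_of_all _ fun l => hsum l x a), integral_finsetSum]
    · refine Finset.sum_congr rfl fun d _ => ?_
      by_cases hd : a = fun i => d i (x i)
      · simp [Strategy.table, pushTable, ← hd]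
      · simp [Strategy.table, pushTable, hd]
    · intro d _
      split_ifs
      · exact hGi d
      · exact integrable_zero _ _ _
  rw [hp]
  refine mixture_mem_LF (c := fun d i => d i (S.query i)) (fun d => integral_nonneg (hG0 d)) ?_
    (fun d => isBehaviour_pushTable (by simp) (by simp)) (fun d => d.localAgency_table) ?_
  · rw [← integral_finsetSum _ fun d _ => hGi d]
    have : ∀ l, ∑ d, G d l = 1 := by
      intro l
      have h2 := Finset.prod_univ_sum
        (fun i => (Finset.univ : Finset ((s : Fin (S.m i)) → Fin (S.o i s))))
        (fun i f => ∏ s, P i s l (f s))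
      rw [Fintype.piFinset_univ] at h2
      rw [← h2]
      refine Finset.prod_eq_one fun i _ => ?_
      have h3 := Finset.prod_univ_sum (fun s => (Finset.univ : Finset (Fin (S.o i s))))
        (fun s v => P i s l v)
      rw [Fintype.piFinset_univ] at h3
      rw [← h3]
      exact Finset.prod_eq_one fun s _ => h1 i s l
    simp [this]
  · intro d x a ha i hi
    obtain ⟨-, rfl⟩ := exists_of_pushTable_ne_zero ha
    simp only
    rw [hi]

theorem mem_bell_of_finite {K : Type} [Fintype K] {p : S.Table} (hp : IsBehaviour p) {w : K → ℝ}
    {P : (i : Fin S.N) → (s : Fin (S.m i)) → K → Fin (S.o i s) → ℝ} (h0 : ∀ k, 0 ≤ w k)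
    (h1 : ∑ k, w k = 1) (hP0 : ∀ i s k a, 0 ≤ P i s k a) (hP1 : ∀ i s k, ∑ a, P i s k a = 1)
    (h : ∀ x a, p x a = ∑ k, w k * ∏ i, P i (x i) k (a i)) : p ∈ S.Bell := by
  let _ : MeasurableSpace K := ⊤
  refine ⟨hp, K, ⊤, ∑ k, ENNReal.ofReal (w k) • Measure.dirac k, P, ⟨?_⟩,
    fun i s a => measurable_from_top, hP0, hP1, fun x a => ?_⟩
  · simp only [Measure.coe_finsetSum, Finset.sum_apply, Measure.smul_apply, measure_univ,
      smul_eq_mul, mul_one]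
    rw [← ENNReal.ofReal_sum_of_nonneg fun k _ => h0 k, h1, ENNReal.ofReal_one]
  · rw [h, integral_finsetSum_measure]
    · refine Finset.sum_congr rfl fun k _ => ?_
      rw [integral_smul_measure, integral_dirac, ENNReal.toReal_ofReal (h0 k), smul_eq_mul]
    · intro k _
      exact (integrable_dirac (by simp)).smul_measure ENNReal.ofReal_ne_top

theorem sum_labelMarginal_update (p : S.Table) (n : Fin S.N) (x : S.Inputs) (l : Fin S.N → ℕ)
    {K : ℕ} (hK : K = S.o n (x n)) :
    ∑ v : Fin K, labelMarginal p Finset.univ x (Function.update l n v) =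
      labelMarginal p {n}ᶜ x l := by
  subst hK
  simp only [labelMarginal]
  rw [Finset.sum_comm]
  refine Finset.sum_congr rfl fun a _ => ?_
  have hiff : ∀ v : Fin (S.o n (x n)), (∀ i ∈ Finset.univ, (a i : ℕ) =
      Function.update l n (v : ℕ) i) ↔ a n = v ∧ ∀ i ∈ ({n}ᶜ : Finset (Fin S.N)),
        (a i : ℕ) = l i := by
    intro v
    constructor
    · intro h
      refine ⟨Fin.ext (by simpa using h n (Finset.mem_univ n)), fun i hi => ?_⟩
      have hi' : i ≠ n := by simpa using hi
      simpa [hi'] using h i (Finset.mem_univ i)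
    · rintro ⟨h1, h2⟩ i -
      by_cases hi : i = n
      · subst hi; simp [h1]
      · simpa [hi] using h2 i (by simpa using hi)
  simp only [hiff, ite_and]
  simp

theorem sum_ite_val_eq {K m : ℕ} (h : m < K) :
    ∑ v : Fin K, (if (v : ℕ) = m then (1 : ℝ) else 0) = 1 := by
  rw [Finset.sum_eq_single_of_mem (⟨m, h⟩ : Fin K) (Finset.mem_univ _)]
  · simp
  · intro v _ hv
    exact if_neg fun h' => hv (Fin.ext h')

/-- The weights of the `e` that agree with `a` on `V` add up to the denominator. If it vanishes,
Local Agency makes the marginal at `y` vanish too, hence also `P y a`. -/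
theorem sum_mul_div_labelMarginal {P : S.Table} (hP : ∀ x a, 0 ≤ P x a) (hL : LocalAgency P)
    {V : Finset (Fin S.N)} {x y : S.Inputs} (hxy : ∀ i ∈ V, x i = y i) (a : S.Outcomes y) :
    (∑ e : S.Outcomes x, if ∀ i ∈ V, (e i : ℕ) = a i then
      P x e * (P y a / labelMarginal P V x fun i => e i) else 0) = P y a := by
  have h1 : (∑ e : S.Outcomes x, if ∀ i ∈ V, (e i : ℕ) = a i then
      P x e * (P y a / labelMarginal P V x fun i => e i) else 0) =
      labelMarginal P V x (fun i => a i) * (P y a / labelMarginal P V x fun i => a i) := by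
    conv_rhs => rw [labelMarginal, Finset.sum_mul]
    refine Finset.sum_congr rfl fun e _ => ?_
    split_ifs with h
    · congr 2
      exact Finset.sum_congr rfl fun a' _ => if_congr
        (forall₂_congr fun i hi => by simp only [h i hi]) rfl rfl
    · rw [zero_mul]
  rw [h1]
  have h2 := le_labelMarginal hP V y a (fun i => a i) fun _ _ => rfl
  rw [← (localAgency_iff P).1 hL V x y hxy] at h2
  by_cases h0 : labelMarginal P V x (fun i => a i) = 0
  · rw [h0] at h2 ⊢
    rw [zero_mul]
    exact le_antisymm (hP y a) h2
  · exact mul_div_cancel₀ _ h0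

/-- If all agents but `n` have a friend and only two measurements, every Local Friendliness
behaviour has a local hidden variable model. -/
theorem LF_compl_singleton_subset_bell (n : Fin S.N) (hm : ∀ i, i ≠ n → S.m i = 2) :
    S.LF {n}ᶜ ⊆ S.Bell := by
  rintro p ⟨hp, w, P, h0, h1, hP, hL, h⟩
  -- For agents other than `n`, this is their only measurement besides the query.
  let X : S.Inputs := fun i => ⟨1, S.two_le_m i⟩
  have hX : ∀ i (s : Fin (S.m i)), i ≠ n → s ≠ S.query i → s = X i := by
    intro i s hi hs
    have h2 := hm i hi
    have h3 := s.2
    have h4 : (s : ℕ) ≠ 0 := fun h => hs (Fin.ext h)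
    exact Fin.ext (show (s : ℕ) = 1 by omega)
  let M : S.FriendOutcomes {n}ᶜ → S.Outcomes X → ℝ := fun c e =>
    labelMarginal (P c) {n}ᶜ X fun i => e i
  let R : (i : Fin S.N) → Fin (S.m i) → S.FriendOutcomes {n}ᶜ → S.Outcomes X → ℕ → ℝ :=
    fun i s c e v => labelMarginal (P c) Finset.univ (Function.update X i s)
      (Function.update (fun i => (e i : ℕ)) i v)
  -- The hidden variable is `(c, e)`, with `e` sampled from `P c` at `X`. Agents other than `n` read
  -- their outcome from `c` or `e`; agent `n` uses the conditional distribution given the others'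
  -- entries of `e`. The default for `M = 0` only concerns hidden variables of weight zero.
  let resp : (i : Fin S.N) → (s : Fin (S.m i)) → S.FriendOutcomes {n}ᶜ × S.Outcomes X →
      Fin (S.o i s) → ℝ := fun i s k v =>
    if hi : i ∈ ({n}ᶜ : Finset (Fin S.N)) then
      if s = S.query i then if (v : ℕ) = k.1 ⟨i, hi⟩ then 1 else 0
      else if (v : ℕ) = k.2 i then 1 else 0
    else if M k.1 k.2 = 0 then if (v : ℕ) = 0 then 1 else 0
    else R i s k.1 k.2 v / M k.1 k.2
  have hlm : ∀ c V x l, 0 ≤ labelMarginal (P c) V x l := fun c V x l =>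
    Finset.sum_nonneg fun a _ => by split_ifs <;> simp [(hP c).1]
  refine mem_bell_of_finite (w := fun k => w k.1 * P k.1 X k.2) (P := resp) hp
    (fun k => mul_nonneg (h0 _) ((hP _).1 _ _)) ?_ ?_ ?_ fun x a => ?_
  · simp only [Fintype.sum_prod_type, ← Finset.mul_sum, (hP _).2, mul_one, h1]
  · intro i s k v
    simp only [resp]
    split_ifs <;> first | exact zero_le_one | exact le_rfl | exact div_nonneg (hlm ..) (hlm ..)
  · intro i s k
    simp only [resp]
    split_ifs with hi hs hM
    · exact sum_ite_val_eq ((k.1 ⟨i, hi⟩).2.trans_eq (congrArg (S.o i) hs.symm))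
    · exact sum_ite_val_eq ((k.2 i).2.trans_eq
        (congrArg (S.o i) (hX i s (by simpa using hi) hs).symm))
    · exact sum_ite_val_eq (by have := S.two_le_o i s; omega)
    · have hin : i = n := by simpa using hi
      subst hin
      rw [← Finset.sum_div, div_eq_one_iff_eq hM]
      simp only [R]
      rw [sum_labelMarginal_update _ _ _ _ (by simp),
        (localAgency_iff _).1 (hL _) _ _ X fun j hj => Function.update_of_ne (by simpa using hj) ..]
  · rw [h, Fintype.sum_prod_type]
    refine Finset.sum_congr rfl fun c _ => ?_
    have hprod : ∀ e : S.Outcomes X, ∏ i ∈ ({n}ᶜ : Finset (Fin S.N)), resp i (x i) (c, e) (a i) =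
        (∏ i ∈ Finset.univ.filter
          (fun i : {i // i ∈ ({n}ᶜ : Finset (Fin S.N))} => x i.1 = S.query i.1),
          if (a i.1 : ℕ) = (c i : ℕ) then (1 : ℝ) else 0) *
        if ∀ i ∈ ({n}ᶜ : Finset (Fin S.N)), x i ≠ S.query i → (a i : ℕ) = e i then 1 else 0 := by
      intro e
      have hB : (if ∀ i ∈ ({n}ᶜ : Finset (Fin S.N)), x i ≠ S.query i → (a i : ℕ) = e i
          then (1 : ℝ) else 0) = ∏ i : {i // i ∈ ({n}ᶜ : Finset (Fin S.N))},
            if x i.1 ≠ S.query i.1 → (a i.1 : ℕ) = e i.1 then 1 else 0 := by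
        simp only [Finset.prod_ite_zero, Finset.prod_const_one, Finset.mem_univ, true_implies,
          Subtype.forall]
      rw [hB, Finset.prod_filter, ← Finset.prod_coe_sort, ← Finset.prod_mul_distrib]
      refine Finset.prod_congr rfl fun i _ => ?_
      simp only [resp, dif_pos i.2]
      by_cases hq : x i.1 = S.query i.1 <;> simp [hq]
    have hresp : ∀ e : S.Outcomes X, P c X e * resp n (x n) (c, e) (a n) =
        P c X e * (R n (x n) c e (a n) / M c e) := by
      intro e
      have hn : n ∉ ({n}ᶜ : Finset (Fin S.N)) := by simp
      simp only [resp, dif_neg hn]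
      by_cases hM : M c e = 0
      · have h2 := le_labelMarginal (hP c).1 {n}ᶜ X e (fun i => e i) fun _ _ => rfl
        rw [le_antisymm (h2.trans_eq hM) ((hP c).1 X e), zero_mul, zero_mul]
      · rw [if_neg hM]
    -- Averaging over `e` undoes the conditioning and sums out the entries of queried agents.
    have key : ∑ e : S.Outcomes X, P c X e * ((R n (x n) c e (a n) / M c e) *
        if ∀ i ∈ ({n}ᶜ : Finset (Fin S.N)), x i ≠ S.query i → (a i : ℕ) = e i then 1 else 0) =
        marginal (P c) (S.queried {n}ᶜ x)ᶜ x a := by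
      have hxy : ∀ i ∈ (S.queried {n}ᶜ x)ᶜ, x i = Function.update X n (x n) i := by
        intro i hi
        by_cases hin : i = n
        · subst hin; simp
        · rw [Function.update_of_ne hin]
          exact hX i (x i) hin fun hq => by simp [queried, hin, hq] at hi
      rw [marginal_eq_labelMarginal, (localAgency_iff _).1 (hL c) _ x _ hxy, labelMarginal]
      have hXy : ∀ i ∈ ({n}ᶜ : Finset (Fin S.N)), X i = Function.update X n (x n) i :=
        fun i hi => (Function.update_of_ne (by simpa using hi) ..).symm
      have hiff : ∀ (e : S.Outcomes X) (a' : S.Outcomes (Function.update X n (x n))),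
          ((∀ i ∈ ({n}ᶜ : Finset (Fin S.N)), x i ≠ S.query i → (a i : ℕ) = e i) ∧
            ∀ i ∈ Finset.univ, (a' i : ℕ) =
              Function.update (fun i => (e i : ℕ)) n (a n : ℕ) i) ↔
          (∀ i ∈ (S.queried {n}ᶜ x)ᶜ, (a' i : ℕ) = a i) ∧
            ∀ i ∈ ({n}ᶜ : Finset (Fin S.N)), (e i : ℕ) = a' i := by
        intro e a'
        simp only [queried, Finset.mem_compl, Finset.mem_filter, Finset.mem_singleton,
          Finset.mem_univ, true_implies]
        constructor
        · rintro ⟨h1, h2⟩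
          have h3 : ∀ i, i ≠ n → (e i : ℕ) = a' i := fun i hi => by
            rw [h2 i, Function.update_of_ne hi]
          refine ⟨fun i hi => ?_, h3⟩
          by_cases hin : i = n
          · rw [h2 i]; subst hin; simp
          · rw [← h3 i hin, h1 i hin fun hq => hi ⟨hin, hq⟩]
        · rintro ⟨h1, h2⟩
          refine ⟨fun i hi hq => ?_, fun i => ?_⟩
          · rw [h2 i hi, h1 i fun h => hq h.2]
          · by_cases hin : i = n
            · rw [h1 i fun h => h.1 hin]; subst hin; simp
            · exact (h2 i hin).symm.trans
                (Function.update_of_ne hin _ fun i => (e i : ℕ)).symm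
      have hR : ∀ e : S.Outcomes X, P c X e * ((R n (x n) c e (a n) / M c e) *
          if ∀ i ∈ ({n}ᶜ : Finset (Fin S.N)), x i ≠ S.query i → (a i : ℕ) = e i then 1 else 0) =
          ∑ a' : S.Outcomes (Function.update X n (x n)),
            if ∀ i ∈ (S.queried {n}ᶜ x)ᶜ, (a' i : ℕ) = a i then
              if ∀ i ∈ ({n}ᶜ : Finset (Fin S.N)), (e i : ℕ) = a' i then
                P c X e * (P c (Function.update X n (x n)) a' / M c e) else 0 else 0 := by
        intro e
        simp only [← ite_and, ← hiff, R]
        by_cases hB : ∀ i ∈ ({n}ᶜ : Finset (Fin S.N)), x i ≠ S.query i → (a i : ℕ) = e i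
        · rw [if_pos hB]
          simp only [labelMarginal, mul_one, Finset.sum_div, Finset.mul_sum]
          refine Finset.sum_congr rfl fun a' _ => ?_
          rw [ite_div, zero_div, mul_ite, mul_zero]
          exact if_congr (and_iff_right hB).symm rfl rfl
        · rw [if_neg hB, mul_zero, mul_zero]
          exact (Finset.sum_eq_zero fun a' _ => if_neg fun h => hB h.1).symm
      simp only [hR]
      rw [Finset.sum_comm]
      refine Finset.sum_congr rfl fun a' _ => ?_
      split_ifs
      · exact sum_mul_div_labelMarginal (hP c).1 (hL c) hXy a'
      · simp
    have hsplit : ∀ e : S.Outcomes X, ∏ i, resp i (x i) (c, e) (a i) =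
        resp n (x n) (c, e) (a n) * ∏ i ∈ ({n}ᶜ : Finset (Fin S.N)), resp i (x i) (c, e) (a i) :=
      fun e => Fintype.prod_eq_mul_prod_compl n _
    rw [← key, Finset.mul_sum, Finset.sum_mul]
    refine Finset.sum_congr rfl fun e _ => ?_
    rw [hsplit, hprod]
    linear_combination (-w c * (∏ i ∈ Finset.univ.filter
          (fun i : {i // i ∈ ({n}ᶜ : Finset (Fin S.N))} => x i.1 = S.query i.1),
          if (a i.1 : ℕ) = (c i : ℕ) then (1 : ℝ) else 0) *
        if ∀ i ∈ ({n}ᶜ : Finset (Fin S.N)), x i ≠ S.query i → (a i : ℕ) = e i then 1 else 0) *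
      hresp e

/-! ### Popescu–Rohrlich boxes -/

section PRBox

variable (j k : Fin S.N) (t₀ t₁ : Fin (S.m k))

/-- The product of the bits that encode the inputs of agents `j` and `k`. -/
def prBit (x : S.Inputs) : Bool := decide (x j ≠ S.query j) && decide (x k = t₁)

/-- The outcomes of a Popescu–Rohrlich box between `j` (query measurement against the others) and
`k` (measurement `t₀` against `t₁`), with shared random bit `r`. -/
def prOutcome (x : S.Inputs) (r : Bool) (i : Fin S.N) : Bool :=
  if i = j then r
  else if i = k ∧ (x k = t₀ ∨ x k = t₁) then r ^^ prBit j k t₁ x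
  else false

/-- The Popescu–Rohrlich box between `j` and `k`; all other outcomes are the first one. -/
def prTable : S.Table :=
  pushTable (K := fun _ => Bool) (fun _ _ => 1 / 2) fun x r i =>
    ⟨(prOutcome j k t₀ t₁ x r i).toNat,
      (Nat.lt_succ_of_le (Bool.toNat_le _)).trans_le (S.two_le_o i (x i))⟩

theorem isBehaviour_prTable : IsBehaviour (prTable j k t₀ t₁) :=
  isBehaviour_pushTable (fun _ _ => by norm_num) fun _ => by simp

theorem localAgency_prTable : LocalAgency (prTable j k t₀ t₁) := by
  rw [localAgency_iff]
  intro V x y hxy l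
  simp only [prTable, labelMarginal_pushTable]
  -- Flipping the shared bit absorbs a change of the product bit; it is needed only if `j`, whose
  -- outcome is that bit, lies outside `V`.
  let b : Bool := if j ∈ V then false else prBit j k t₁ x ^^ prBit j k t₁ y
  have hb : Function.Involutive fun r : Bool => r ^^ b := fun r => by simp
  refine Fintype.sum_equiv hb.toPerm _ _ fun r => if_congr (forall₂_congr fun i hi => ?_) rfl rfl
  have key : prOutcome j k t₀ t₁ x r i = prOutcome j k t₀ t₁ y (r ^^ b) i := by
    by_cases hij : i = j
    · subst hij; simp [prOutcome, b, hi]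
    by_cases hik : i = k
    · subst hik
      simp only [prOutcome, if_neg hij, true_and, hxy i hi]
      refine if_congr Iff.rfl ?_ rfl
      by_cases hj : j ∈ V
      · simp [b, hj, prBit, hxy i hi, hxy j hj]
      · simp [b, hj]
    · simp [prOutcome, hij, hik]
  simp [key]

variable {j k t₀ t₁}

/-- Every queried friend has the constant outcome `0`, so a single component suffices. -/
theorem prTable_mem_LF {F : Finset (Fin S.N)} (hj : j ∉ F)
    (hk : k ∈ F → t₀ ≠ S.query k ∧ t₁ ≠ S.query k) : prTable j k t₀ t₁ ∈ S.LF F := by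
  have : prTable j k t₀ t₁ = mixture (fun _ : Unit => 1) fun _ => prTable j k t₀ t₁ := by
    funext x a
    simp [mixture]
  rw [this]
  refine mixture_mem_LF
    (c := fun _ i => ⟨0, by have := S.two_le_o i.1 (S.query i.1); omega⟩) (by simp) (by simp)
    (fun _ => isBehaviour_prTable ..) (fun _ => localAgency_prTable j k t₀ t₁) fun _ x a ha i hi => ?_
  obtain ⟨r, rfl⟩ := exists_of_pushTable_ne_zero ha
  have hij : i.1 ≠ j := fun h => hj (h ▸ i.2)
  have hik : ¬ (i.1 = k ∧ (x k = t₀ ∨ x k = t₁)) := by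
    rintro ⟨h, h'⟩
    have hk' := hk (h ▸ i.2)
    have hq : x k = S.query k := h ▸ hi
    rw [hq] at h'
    exact h'.elim (fun h => hk'.1 h.symm) fun h => hk'.2 h.symm
  simp [prOutcome, hij, hik]

theorem prTable_not_mem_LF {F : Finset (Fin S.N)} (hj : j ∈ F) (hjk : j ≠ k) (ht : t₀ ≠ t₁) :
    prTable j k t₀ t₁ ∉ S.LF F := by
  intro hp
  obtain ⟨w, Q, h0, h1, hQ, hL, hc, hmix⟩ := exists_mixture_of_mem_LF hp
  obtain ⟨c, -, hwc⟩ := Finset.exists_ne_zero_of_sum_ne_zero (h1.trans_ne one_ne_zero)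
  -- A component of positive weight inherits the perfect PR correlations.
  have hsupp : ∀ x a, Q c x a ≠ 0 → (x k = t₀ ∨ x k = t₁) → ∃ r : Bool,
      (a j : ℕ) = r.toNat ∧ (a k : ℕ) = (r ^^ prBit j k t₁ x).toNat := by
    intro x a ha hx
    have hne : prTable j k t₀ t₁ x a ≠ 0 := by
      rw [hmix]
      intro hz
      have := (Finset.sum_eq_zero_iff_of_nonneg
        (fun d _ => mul_nonneg (h0 d) ((hQ d).1 x a))).1 hz c (Finset.mem_univ c)
      exact mul_ne_zero hwc ha this
    obtain ⟨r, rfl⟩ := exists_of_pushTable_ne_zero hne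
    exact ⟨r, by simp [prOutcome], by simp [prOutcome, hjk.symm, hx]⟩
  let z : Fin (S.m j) → Fin (S.m k) → S.Inputs := fun s t =>
    Function.update (Function.update S.query j s) k t
  have hzj : ∀ s t, z s t j = s := fun s t => by simp [z, hjk]
  have hzk : ∀ s t, z s t k = t := fun s t => by simp [z]
  let α : Fin (S.m j) := ⟨1, S.two_le_m j⟩
  have hα : α ≠ S.query j := by simp [α, query]
  -- When `j` queries, the product bit is `0`, so `k` must copy the fixed outcome of `j`.
  have hquery : ∀ t, (t = t₀ ∨ t = t₁) → ∀ a, Q c (z (S.query j) t) a ≠ 0 →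
      (a k : ℕ) = c ⟨j, hj⟩ := by
    intro t htt a ha
    obtain ⟨r, hr1, hr2⟩ := hsupp _ a ha (by simpa only [hzk] using htt)
    rw [← hc c _ a ha ⟨j, hj⟩ (hzj _ _), hr1, hr2]
    simp [prBit, hzj]
  have hk : ∀ t, (t = t₀ ∨ t = t₁) → ∀ a, Q c (z α t) a ≠ 0 → (a k : ℕ) = c ⟨j, hj⟩ :=
    fun t htt => (hL c).label_eq_of_forall (hQ c).1 (by rw [hzk, hzk]) (hquery t htt)
  -- The product bit is still `0` at `t₀`, so now the outcome of `j` is forced by that of `k`. By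
  -- Local Agency it is the same at `t₁`, where the box demands different outcomes.
  have hj0 : ∀ a, Q c (z α t₀) a ≠ 0 → (a j : ℕ) = c ⟨j, hj⟩ := by
    intro a ha
    obtain ⟨r, hr1, hr2⟩ := hsupp _ a ha (.inl (hzk _ _))
    rw [← hk t₀ (.inl rfl) a ha, hr1, hr2]
    simp [prBit, hzk, ht]
  obtain ⟨a, ha⟩ := (hQ c).exists_ne_zero (z α t₁)
  have hj1 := (hL c).label_eq_of_forall (hQ c).1 (by rw [hzj, hzj]) hj0 a ha
  have hk1 := hk t₁ (.inr rfl) a ha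
  obtain ⟨r, hr1, hr2⟩ := hsupp _ a ha (.inr (hzk _ _))
  have hbit : prBit j k t₁ (z α t₁) = true := by simp [prBit, hzj, hzk, hα]
  rw [hbit] at hr2
  have : r.toNat = (r ^^ true).toNat := by rw [← hr1, ← hr2, hj1, hk1]
  cases r <;> simp at this

end PRBox

/-! ### Comparison of the Local Friendliness sets. -/

theorem not_LF_subset_LF {F F' : Finset (Fin S.N)} (hss : F' ⊂ F)
    (h : ¬ (F = Finset.univ ∧ F'.card + 1 = S.N ∧ ∀ j ∈ F', S.m j = 2)) :
    ¬ S.LF F' ⊆ S.LF F := by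
  have hsub := hss.1
  obtain ⟨j, hj, hj'⟩ := Finset.exists_of_ssubset hss
  suffices ∃ k, j ≠ k ∧ ∃ t₀ t₁ : Fin (S.m k), t₀ ≠ t₁ ∧
      (k ∈ F' → t₀ ≠ S.query k ∧ t₁ ≠ S.query k) by
    obtain ⟨k, hjk, t₀, t₁, ht, hk⟩ := this
    exact fun hLF => prTable_not_mem_LF hj hjk ht (hLF (prTable_mem_LF hj' hk))
  -- With a third measurement, a friend's agent `k` has two that are not the query.
  by_cases h3 : ∃ k ∈ F', S.m k ≠ 2
  · obtain ⟨k, hk, h3⟩ := h3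
    have h2 := S.two_le_m k
    refine ⟨k, fun h => hj' (h ▸ hk), ⟨1, h2⟩, ⟨2, by omega⟩, ?_, fun _ => ⟨?_, ?_⟩⟩ <;>
      simp [query]
  push Not at h3
  -- An agent without a friend in `F'` may use any two measurements, the query included.
  by_cases h4 : ∃ k, k ∉ F' ∧ j ≠ k
  · obtain ⟨k, hk, hjk⟩ := h4
    exact ⟨k, hjk, S.query k, ⟨1, S.two_le_m k⟩, by simp [query], fun h => absurd h hk⟩
  push Not at h4
  refine absurd ⟨?_, ?_, h3⟩ h
  · refine Finset.eq_univ_of_forall fun k => ?_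
    by_cases hk : k ∈ F'
    · exact hsub hk
    · exact h4 k hk ▸ hj
  · have : F' = {j}ᶜ := by
      ext k
      simp only [Finset.mem_compl, Finset.mem_singleton]
      exact ⟨fun hk h => hj' (h ▸ hk), fun hk => by_contra fun h => hk (h4 k h).symm⟩
    have h2 := S.two_le_N
    rw [this, Finset.card_compl, Finset.card_singleton, Fintype.card_fin]
    omega

theorem LF_subset_bell {F : Finset (Fin S.N)} (hF : F.card + 1 = S.N)
    (hm : ∀ j ∈ F, S.m j = 2) : S.LF F ⊆ S.Bell := by
  have h1 : Fᶜ.card = 1 := by rw [Finset.card_compl, Fintype.card_fin]; omega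
  obtain ⟨n, hn⟩ := Finset.card_eq_one.1 h1
  obtain rfl : F = {n}ᶜ := by rw [← hn, compl_compl]
  exact LF_compl_singleton_subset_bell n fun i hi => hm i (by simpa using hi)

end PublicScenario

end LocalFriendliness

end

theorem mainTheorem4 (S : LocalFriendliness.PublicScenario)
    (I_F I_F' : Finset (Fin S.N)) (hne : I_F'.Nonempty) (hss : I_F' ⊂ I_F) :
    ((S.LF I_F = S.LF I_F' ∧ S.LF I_F' = S.Bell) ∨ S.LF I_F ⊂ S.LF I_F') ∧
    (S.LF I_F = S.LF I_F' ↔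
      I_F = Finset.univ ∧ I_F'.card + 1 = S.N ∧ ∀ j ∈ I_F', S.m j = 2) := by
  have hle := LocalFriendliness.PublicScenario.LF_anti hss.1
  by_cases h : I_F = Finset.univ ∧ I_F'.card + 1 = S.N ∧ ∀ j ∈ I_F', S.m j = 2
  · have hB := LocalFriendliness.PublicScenario.LF_subset_bell h.2.1 h.2.2
    have h1 := LocalFriendliness.PublicScenario.bell_subset_LF I_F
    have heq := hle.antisymm (hB.trans h1)
    exact ⟨.inl ⟨heq, hB.antisymm (h1.trans hle)⟩, iff_of_true heq h⟩
  · have hnot := LocalFriendliness.PublicScenario.not_LF_subset_LF hss h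
    exact ⟨.inr ⟨hle, hnot⟩, iff_of_false (fun heq => hnot heq.ge) h⟩
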